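/- Consider the uncertain control-affine system $x^+ = f(x,v) + g(x,v)u$ with state $x\in\mathbb R^n$, input $u\in\mathbb R^m$ and uncertain input $v\in\mathcal V$ of law $\mathbb P$, where $f,g$ are measurable, and let $\mathbb X\subseteq\mathbb R^n$, $\mathbb U\subseteq\mathbb R^m$ be compact convex constraint sets. Let $K\ge 1$ be the horizon and write $\phi(k;x,\mathbf u,\mathbf v)$, $0\le k\le K$, for the solution started at $x$ under $\mathbf u=(u_0,\dots,u_{K-1})$ and $\mathbf v=(v_0,\dots,v_{K-1})$. For $x\in\mathbb R^n$ and $\mathbb U_0\subseteq\mathbb R^m$, the first-stage probability of violation is $$V^{\rm MPC}(x,\mathbb U_0)=\sup_{u\in\mathbb U_0}\mathbb P\left(\{v\in\mathcal V: f(x,v)+g(x,v)u\notin\mathbb X\}\right),$$ with $V^{\rm MPC}(x,\varnothing)=0$. Fix $\hat u_0\in\mathbb R^m$, directions $c_1,\dots,c_M\in\mathbb R^m$ and a number $N$ of first-stage samples. Given $x$ and $\mathbf v_0=(v_0^{(1)},\dots,v_0^{(N)})\in\mathcal V^N$, let $\lambda_j^\star$ be the largest $\lambda\in\mathbb R$ such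 that $\hat u_0+\lambda c_j\in\mathbb U$ and $f(x,v_0^{(i)})+g(x,v_0^{(i)})(\hat u_0+\lambda c_j)\in\mathbb X$ for $i=1,\dots,N$. Let $\mathbb U_M(x;\mathbf v_0)$ be the convex hull of the points $\hat u_0+\lambda_j^\star c_j$ over those $j$ for which $\lambda_j^\star$ exists. Given $x$, sampled sequences $\mathbf v^{(1)},\mathbf v^{(2)},\dots\in\mathcal V^K$ and an index set $\mathcal I_2$, call $\mathbf u\in\mathbb U^K$ feasible for $\mathrm{SP}^{\rm MPC}$ if $\phi(1;x,\mathbf u,\mathbf v^{(i)})\in\mathbb X$ for $1\le i\le N$ and $\phi(k;x,\mathbf u,\mathbf v^{(i)})\in\mathbb X$ for $i\in\mathcal I_2$, $2\le k\le K$. Call $\mathbf u\in\mathbb U^K$ feasible for $\widetilde{\mathrm{SP}}^{\rm MPC}$ if instead of the first of these conditions $u_0\in\mathbb U_M(x;\mathbf v_0)$ holds, where $\mathbf v_0=(v_0^{(1)},\dots,v_0^{(N)})$ consists of the first entries of $\mathbf v^{(1)},\dots,\mathbf v^{(N)}$. Closed loop: start at $x_0\in\mathbb X$. At each time $k\ge0$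 draw fresh samples $\mathbf v^{(1)}(k),\mathbf v^{(2)}(k),\dots$ and let an uncertain input $w_k$ act on the system, all sample entries and all $w_k$ being independent with law $\mathbb P$. Let the input be computed by a measurable law $\kappa$ from the state and the samples drawn at that time, so that $x_{k+1}=f(x_k,w_k)+g(x_k,w_k)\,\kappa\left(x_k,(\mathbf v^{(i)}(k))_i\right)$. Assume that at every time $k$, almost surely, (recursive feasibility) $\mathrm{SP}^{\rm MPC}$ at $x_k$ with the samples drawn at time $k$ has a feasible solution, and (receding-horizon law) the applied input $\kappa(x_k,\cdot)$ is the first element $u_0$ of some feasible solution of $\widetilde{\mathrm{SP}}^{\rm MPC}$ at $x_k$ with these samples. Let $\varepsilon\in(0,1)$, let $\Phi(\epsilon,\zeta,N)=\sum_{j=0}^{\zeta-1}\binom Nj\epsilon^j(1-\epsilon)^{N-j}$, and suppose that $N\ge2$ and $$\int_0^1 M\,\Phi\left(\frac{\nu}{\min\{m+1,M\}},1,N\right)d\nu\le\varepsilon .$$ Then for every $k\ge0$ the expectation below is well defined and $$\mathbb E\left[V^{\rm MPC}\left(x_k,\mathbb U_M(x_k;\mathbf v_0(k))\right)\right]\le\varepsilon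 ,$$ where $\mathbf v_0(k)=(v_0^{(1)}(k),\dots,v_0^{(N)}(k))$. -/

import Mathlib

open MeasureTheory
open scoped ENNReal

/-- The binomial tail `Φ(ε, ζ, N) = ∑_{j=0}^{ζ-1} C(N, j) ε^j (1-ε)^(N-j)`. -/
noncomputable def binomTail (ε : ℝ) (ζ N : ℕ) : ℝ :=
  ∑ j ∈ Finset.range ζ, (N.choose j : ℝ) * ε ^ j * (1 - ε) ^ (N - j)

/-- The data of an uncertain control-affine system `x⁺ = f(x, v) + g(x, v) u` with state in `ℝⁿ`,
input in `ℝᵐ`, uncertain input in `V`, together with its state and input constraint sets. -/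
structure ControlAffineSystem (n m : ℕ) (V : Type*) where
  /-- drift term -/
  f : (Fin n → ℝ) → V → (Fin n → ℝ)
  /-- input matrix -/
  g : (Fin n → ℝ) → V → Matrix (Fin n) (Fin m) ℝ
  /-- state constraint set -/
  stateSet : Set (Fin n → ℝ)
  /-- input constraint set -/
  inputSet : Set (Fin m → ℝ)

/-- The samples drawn at one time step: sample number `i` (numbered from `0`) is an
uncertain-input sequence `(v₀, …, v_{K-1})` over the horizon. -/
abbrev Scenarios (K : ℕ) (V : Type*) : Type _ := ℕ → Fin K → V

namespace ControlAffineSystem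

variable {n m : ℕ} {V : Type*} (S : ControlAffineSystem n m V)

/-- The successor state `f(x, v) + g(x, v) u`. -/
def next (x : Fin n → ℝ) (u : Fin m → ℝ) (v : V) : Fin n → ℝ :=
  S.f x v + (S.g x v).mulVec u

/-- The open-loop solution `φ(k; x, u, v)`, `0 ≤ k ≤ K`. -/
def openLoop {K : ℕ} (x : Fin n → ℝ) (u : Fin K → Fin m → ℝ) (v : Fin K → V) :
    Fin (K + 1) → Fin n → ℝ :=
  Fin.induction (motive := fun _ => Fin n → ℝ) x (fun k z => S.next z (u k) (v k))

/-- First-stage probability of violation of a set `U₀` of inputs at the state `x`. -/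
noncomputable def firstStageViolation [MeasurableSpace V] (P : Measure V) (x : Fin n → ℝ)
    (U₀ : Set (Fin m → ℝ)) : ℝ≥0∞ :=
  ⨆ u ∈ U₀, P {v | S.next x u v ∉ S.stateSet}

/-- Feasible set of the one-dimensional scenario program along the line `λ ↦ û + λ c`, with the
`N` first-stage samples `v`. -/
def lineFeasible {N : ℕ} (uhat c : Fin m → ℝ) (x : Fin n → ℝ) (v : Fin N → V) : Set ℝ :=
  {r | (∀ i, S.next x (uhat + r • c) (v i) ∈ S.stateSet) ∧ uhat + r • c ∈ S.inputSet}

/-- The set `𝕌_M`: the convex hull of the points `û + λ_j⋆ c_j`, where `λ_j⋆` is the optimizer of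
"minimize `-λ` over the feasible set along the `j`-th line"; lines whose program has no optimizer
contribute no point. -/
def hullSet {M N : ℕ} (uhat : Fin m → ℝ) (c : Fin M → Fin m → ℝ) (x : Fin n → ℝ)
    (v : Fin N → V) : Set (Fin m → ℝ) :=
  convexHull ℝ {u | ∃ j : Fin M, ∃ r : ℝ,
    IsGreatest (S.lineFeasible uhat (c j) x v) r ∧ u = uhat + r • c j}

/-- First-stage samples: the first entries of samples number `0, …, N-1`. -/
def firstStageSamples {K : ℕ} [NeZero K] (N : ℕ) (s : Scenarios K V) : Fin N → V :=
  fun i => s i 0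

/-- `u` is a feasible solution of the sampled MPC program at `x`: the first-stage constraint is
imposed for samples number `0, …, N-1`, the later-stage constraints for samples in `I₂`. -/
def IsFeasibleMPC {K : ℕ} [NeZero K] (N : ℕ) (I₂ : Set ℕ) (x : Fin n → ℝ) (s : Scenarios K V)
    (u : Fin K → Fin m → ℝ) : Prop :=
  (∀ k, u k ∈ S.inputSet) ∧
  (∀ i < N, S.openLoop x u (s i) 1 ∈ S.stateSet) ∧
  ∀ i ∈ I₂, ∀ k : Fin (K + 1), 2 ≤ (k : ℕ) → S.openLoop x u (s i) k ∈ S.stateSet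

/-- `u` is a feasible solution of the approximate sampled MPC program at `x`, in which the
first-stage constraint is replaced by `u₀ ∈ 𝕌_M`. -/
def IsFeasibleApproxMPC {K M : ℕ} [NeZero K] (N : ℕ) (I₂ : Set ℕ) (uhat : Fin m → ℝ)
    (c : Fin M → Fin m → ℝ) (x : Fin n → ℝ) (s : Scenarios K V) (u : Fin K → Fin m → ℝ) : Prop :=
  (∀ k, u k ∈ S.inputSet) ∧
  u 0 ∈ S.hullSet uhat c x (firstStageSamples N s) ∧
  ∀ i ∈ I₂, ∀ k : Fin (K + 1), 2 ≤ (k : ℕ) → S.openLoop x u (s i) k ∈ S.stateSet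

/-- The closed-loop state `φ_κ(k; x, ω)`. Here `(ω t).1` are the samples drawn at time `t`, from
which the control input `κ (state) (samples)` is computed, and `(ω t).2` is the uncertain input
that acts on the system at time `t`. -/
def closedLoop {K : ℕ} (κ : (Fin n → ℝ) → Scenarios K V → (Fin m → ℝ)) (x : Fin n → ℝ)
    (ω : ℕ → Scenarios K V × V) : ℕ → Fin n → ℝ
  | 0 => x
  | k + 1 => S.next (closedLoop κ x ω k) (κ (closedLoop κ x ω k) (ω k).1) (ω k).2

end ControlAffineSystem

/-- The joint law of all samples and uncertain inputs over time: all of them are independent with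
law `P`. -/
noncomputable def closedLoopMeasure {V : Type*} [MeasurableSpace V] (P : Measure V)
    [IsProbabilityMeasure P] (K : ℕ) : Measure (ℕ → Scenarios K V × V) :=
  Measure.infinitePi fun _ : ℕ =>
    (Measure.infinitePi fun _ : ℕ => Measure.pi fun _ : Fin K => P).prod P

/-! The state at time `k` depends only on earlier draws, so it is independent of the first-stage
samples drawn at time `k`. It therefore suffices to bound the expected violation at a fixed state.
All that survives of the control law is that the hull is almost surely nonempty, since it contains
the applied input.

The dynamics are affine in the input and the state set is convex, so a hull point can violate only
where some vertex does. The violation of the hull is thus at most the sum over the lines of the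
violations of their optimizers. By exchangeability, `N + 1` times the expected violation on a line
is the expected number of indices among `N + 1` samples whose removal yields an optimizer that the
removed sample rejects (`sum_lintegral_lineViolation_le`). The feasible parameters of one sample
form an interval. Hence at most two removals per line violate, and at most one if all `N + 1`
intervals meet.

With `L = min (m + 1) M` the integral equals `M * L * (1 - (1 - 1/L)^(N+1)) / (N + 1)`. For `L ≥ 3`
it is at least `2M / (N + 1)`, so the crude count suffices. If `M = 1` or `m = 1`, a nonempty hull
makes every line of nonzero direction feasible, and Helly's theorem lowers the count to one per
line. There remains `M = 2` with `m ≥ 2`. There Helly gives a total count of 3 for `N ≥ 4`, `N = 3`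
needs a direct estimate, and for `N = 2` the bound exceeds 1. -/

/-- Removing the `i`-th set from the family `I` leaves an intersection whose greatest element exists
and violates `I i`. -/
def RemovalViolates {N : ℕ} (I : Fin (N + 1) → Set ℝ) (i : Fin (N + 1)) : Prop :=
  ∃ r, IsGreatest (⋂ k : Fin N, I (i.succAbove k)) r ∧ r ∉ I i

/-! ### Violating removals in families of intervals -/

section Intervals

variable {N : ℕ} {I : Fin (N + 1) → Set ℝ}

theorem mem_of_isGreatest_removal {i l : Fin (N + 1)} {r : ℝ}
    (h : IsGreatest (⋂ k : Fin N, I (i.succAbove k)) r) (hl : l ≠ i) : r ∈ I l := by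
  obtain ⟨k, rfl⟩ := Fin.exists_succAbove_eq hl
  exact Set.mem_iInter.1 h.1 k

/-- For two distinct indices each optimizer lies in the interval removed for the other, which forces
both `s < r` and `r < s`. -/
theorem removal_left_unique {i l : Fin (N + 1)} {r s : ℝ}
    (hi : IsGreatest (⋂ k : Fin N, I (i.succAbove k)) r) (hir : ∀ y ∈ I i, y < r)
    (hl : IsGreatest (⋂ k : Fin N, I (l.succAbove k)) s) (hls : ∀ y ∈ I l, y < s) : i = l := by
  by_contra hne
  exact lt_asymm (hir s (mem_of_isGreatest_removal hl hne)) (hls r (mem_of_isGreatest_removal hi (Ne.symm hne)))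

theorem removal_right_unique {i l : Fin (N + 1)} {r s : ℝ}
    (hi : IsGreatest (⋂ k : Fin N, I (i.succAbove k)) r) (hir : ∀ y ∈ I i, r < y)
    (hl : IsGreatest (⋂ k : Fin N, I (l.succAbove k)) s) (hls : ∀ y ∈ I l, s < y) : i = l := by
  by_contra hne
  exact lt_asymm (hir s (mem_of_isGreatest_removal hl hne)) (hls r (mem_of_isGreatest_removal hi (Ne.symm hne)))

theorem forall_lt_or_forall_gt_of_notMem {s : Set ℝ} (hs : Convex ℝ s) {r : ℝ} (hr : r ∉ s) :
    (∀ y ∈ s, y < r) ∨ ∀ y ∈ s, r < y := by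
  by_contra! h
  obtain ⟨⟨y, hy, hry⟩, z, hz, hzr⟩ := h
  exact hr (hs.ordConnected.out hz hy ⟨hzr, hry⟩)

-- An interval missing the optimizer lies entirely on one side of it, and each side accounts for at
-- most one index.
open Classical in
theorem card_removalViolates_le_two (hI : ∀ i, Convex ℝ (I i)) :
    (Finset.univ.filter (RemovalViolates I)).card ≤ 2 := by
  have hsub : Finset.univ.filter (RemovalViolates I) ⊆
      (Finset.univ.filter fun i => ∃ r, IsGreatest (⋂ k : Fin N, I (i.succAbove k)) r ∧
        ∀ y ∈ I i, y < r) ∪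
      Finset.univ.filter fun i => ∃ r, IsGreatest (⋂ k : Fin N, I (i.succAbove k)) r ∧
        ∀ y ∈ I i, r < y := by
    intro i hi
    obtain ⟨r, hr, hri⟩ := (Finset.mem_filter.1 hi).2
    simp only [Finset.mem_union, Finset.mem_filter, Finset.mem_univ, true_and]
    exact (forall_lt_or_forall_gt_of_notMem (hI i) hri).imp (⟨r, hr, ·⟩) (⟨r, hr, ·⟩)
  refine (Finset.card_le_card hsub).trans ((Finset.card_union_le _ _).trans ?_)
  refine add_le_add (Finset.card_le_one.2 ?_) (Finset.card_le_one.2 ?_)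
  · intro i hi l hl
    obtain ⟨r, hr, hri⟩ := (Finset.mem_filter.1 hi).2
    obtain ⟨s, hs, hsl⟩ := (Finset.mem_filter.1 hl).2
    exact removal_left_unique hr hri hs hsl
  · intro i hi l hl
    obtain ⟨r, hr, hri⟩ := (Finset.mem_filter.1 hi).2
    obtain ⟨s, hs, hsl⟩ := (Finset.mem_filter.1 hl).2
    exact removal_right_unique hr hri hs hsl

-- A common point of all the intervals is at most every removal optimizer, so a violating interval
-- can only lie to the left.
open Classical in
theorem card_removalViolates_le_one (hI : ∀ i, Convex ℝ (I i)) (hne : (⋂ i, I i).Nonempty) :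
    (Finset.univ.filter (RemovalViolates I)).card ≤ 1 := by
  obtain ⟨z, hz⟩ := hne
  rw [Set.mem_iInter] at hz
  have key : ∀ i r, IsGreatest (⋂ k : Fin N, I (i.succAbove k)) r → r ∉ I i →
      ∀ y ∈ I i, y < r := by
    intro i r hr hri
    refine (forall_lt_or_forall_gt_of_notMem (hI i) hri).resolve_right fun h => ?_
    exact (h z (hz i)).not_ge (hr.2 (Set.mem_iInter.2 fun k => hz _))
  refine Finset.card_le_one.2 fun i hi l hl => ?_
  obtain ⟨r, hr, hri⟩ := (Finset.mem_filter.1 hi).2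
  obtain ⟨s, hs, hsl⟩ := (Finset.mem_filter.1 hl).2
  exact removal_left_unique hr (key i r hr hri) hs (key l s hs hsl)

/-- Helly's theorem on the line. -/
theorem iInter_nonempty_of_pairwise {ι : Type*} [Fintype ι] {I : ι → Set ℝ}
    (hI : ∀ i, Convex ℝ (I i)) (h : ∀ i k, (I i ∩ I k).Nonempty) : (⋂ i, I i).Nonempty := by
  classical
  have := Convex.helly_theorem' (𝕜 := ℝ) (F := I) (s := Finset.univ) (fun i _ => hI i) ?_
  · simpa using this
  · intro J _ hJ
    rw [Module.finrank_self] at hJ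
    interval_cases hc : J.card
    · rw [Finset.card_eq_zero] at hc
      simp [hc]
    · obtain ⟨i, rfl⟩ := Finset.card_eq_one.1 hc
      simpa using h i i
    · obtain ⟨i, k, -, rfl⟩ := Finset.card_eq_two.1 hc
      simpa [Set.iInter_or, Set.iInter_inter_distrib] using h i k

/-- By Helly only pairs matter. Among at least three indices some third one can be removed, and that
leaves the given pair with a common point. -/
theorem iInter_nonempty_of_removals (hN : 2 ≤ N) (hI : ∀ i, Convex ℝ (I i))
    (h : ∀ l : Fin (N + 1), (⋂ k : Fin N, I (l.succAbove k)).Nonempty) :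
    (⋂ i, I i).Nonempty := by
  classical
  refine iInter_nonempty_of_pairwise hI fun i k => ?_
  obtain ⟨l, -, hl⟩ := Finset.exists_mem_notMem_of_card_lt_card (s := {i, k})
    (t := (Finset.univ : Finset (Fin (N + 1))))
    (by rw [Finset.card_univ, Fintype.card_fin]; exact Finset.card_le_two.trans_lt (by omega))
  simp only [Finset.mem_insert, Finset.mem_singleton, not_or] at hl
  obtain ⟨r, hr⟩ := h l
  rw [Set.mem_iInter] at hr
  obtain ⟨i', rfl⟩ := Fin.exists_succAbove_eq (Ne.symm hl.1)
  obtain ⟨k', rfl⟩ := Fin.exists_succAbove_eq (Ne.symm hl.2)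
  exact ⟨r, hr i', hr k'⟩

open Classical in
/-- Two families such that every removal leaves one of them with common points. -/
theorem card_removalViolates_add_le_three {J : Fin (N + 1) → Set ℝ} (hN : 4 ≤ N)
    (hI : ∀ i, Convex ℝ (I i)) (hJ : ∀ i, Convex ℝ (J i))
    (h : ∀ l : Fin (N + 1), (⋂ k : Fin N, I (l.succAbove k)).Nonempty ∨
      (⋂ k : Fin N, J (l.succAbove k)).Nonempty) :
    (Finset.univ.filter (RemovalViolates I)).card +
      (Finset.univ.filter (RemovalViolates J)).card ≤ 3 := by
  have hI2 := card_removalViolates_le_two hI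
  have hJ2 := card_removalViolates_le_two hJ
  by_cases hIn : (⋂ i, I i).Nonempty
  · have := card_removalViolates_le_one hI hIn
    omega
  by_cases hJn : (⋂ i, J i).Nonempty
  · have := card_removalViolates_le_one hJ hJn
    omega
  -- If neither family has a common point, Helly gives a disjoint pair in each. These pairs use at
  -- most four of the at least five indices, so removing a fifth leaves both families without a
  -- common point.
  exfalso
  have hI' := mt (iInter_nonempty_of_pairwise hI) hIn
  have hJ' := mt (iInter_nonempty_of_pairwise hJ) hJn
  push Not at hI' hJ'
  obtain ⟨a, b, hab⟩ := hI'
  obtain ⟨c, d, hcd⟩ := hJ'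
  obtain ⟨l, -, hl⟩ := Finset.exists_mem_notMem_of_card_lt_card (s := {a, b, c, d})
    (t := (Finset.univ : Finset (Fin (N + 1))))
    (by rw [Finset.card_univ, Fintype.card_fin]; exact Finset.card_le_four.trans_lt (by omega))
  simp only [Finset.mem_insert, Finset.mem_singleton, not_or] at hl
  obtain ⟨a', rfl⟩ := Fin.exists_succAbove_eq (Ne.symm hl.1)
  obtain ⟨b', rfl⟩ := Fin.exists_succAbove_eq (Ne.symm hl.2.1)
  obtain ⟨c', rfl⟩ := Fin.exists_succAbove_eq (Ne.symm hl.2.2.1)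
  obtain ⟨d', rfl⟩ := Fin.exists_succAbove_eq (Ne.symm hl.2.2.2)
  rcases h l with ⟨r, hr⟩ | ⟨r, hr⟩ <;> rw [Set.mem_iInter] at hr
  · exact (hab ▸ (⟨hr a', hr b'⟩ : r ∈ I _ ∩ I _) : r ∈ (∅ : Set ℝ))
  · exact (hcd ▸ (⟨hr c', hr d'⟩ : r ∈ J _ ∩ J _) : r ∈ (∅ : Set ℝ))

/-- The greatest common point of compact intervals is the greatest point of one of them. -/
theorem exists_isGreatest_of_isGreatest_iInter {ι : Type*} [Finite ι] [Nonempty ι]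
    {I : ι → Set ℝ} (hI : ∀ i, Convex ℝ (I i)) (hc : ∀ i, IsCompact (I i)) {r : ℝ}
    (hr : IsGreatest (⋂ i, I i) r) : ∃ i, IsGreatest (I i) r := by
  have hmem := Set.mem_iInter.1 hr.1
  choose b hb using fun i => (hc i).exists_isGreatest ⟨r, hmem i⟩
  -- The smallest right endpoint lies between `r` and every other right endpoint, hence in every
  -- interval.
  obtain ⟨i, hi⟩ := Finite.exists_min b
  have hle : r ≤ b i := (hb i).2 (hmem i)
  have : b i ≤ r := hr.2 (Set.mem_iInter.2 fun k =>
    (hI k).ordConnected.out (hmem k) (hb k).1 ⟨hle, hi k⟩)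
  exact ⟨i, le_antisymm hle this ▸ hb i⟩

end Intervals

/-! ### Measurability and geometry of the scenario program on one line -/

/-- Whether a random continuous path meets a closed set during a compact time interval is a
measurable event. -/
theorem measurableSet_exists_mem_Icc {Ω E : Type*} [MeasurableSpace Ω] [PseudoEMetricSpace E]
    [MeasurableSpace E] [OpensMeasurableSpace E] {h : Ω → ℝ → E}
    (hm : ∀ r, Measurable fun p => h p r) (hc : ∀ p, Continuous (h p)) {Y : Set E}
    (hY : IsClosed Y) (s t : ℝ) : MeasurableSet {p | ∃ r ∈ Set.Icc s t, h p r ∈ Y} := by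
  obtain ⟨D, hDc, hDd⟩ := TopologicalSpace.exists_countable_dense (Set.Icc s t)
  have hφ : ∀ p, Continuous fun r : Set.Icc s t => Metric.infEDist (h p r) Y := fun p =>
    Metric.continuous_infEDist.comp ((hc p).comp continuous_subtype_val)
  -- The distance to `Y` attains its minimum over the compact interval, so the path meets `Y`
  -- exactly when the distance becomes arbitrarily small on a countable dense set of times.
  have heq : {p | ∃ r ∈ Set.Icc s t, h p r ∈ Y} =
      ⋂ k : ℕ, ⋃ d ∈ D, {p | Metric.infEDist (h p (d : ℝ)) Y < ((k : ℝ≥0∞) + 1)⁻¹} := by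
    ext p
    simp only [Set.mem_ofPred_eq, Set.mem_iInter, Set.mem_iUnion]
    constructor
    · rintro ⟨r, hr, hrY⟩ k
      have hopen : IsOpen {r : Set.Icc s t |
          Metric.infEDist (h p r) Y < ((k : ℝ≥0∞) + 1)⁻¹} :=
        isOpen_lt (hφ p) continuous_const
      obtain ⟨d, hd, hdD⟩ := hDd.inter_open_nonempty _ hopen
        ⟨⟨r, hr⟩, by
          change Metric.infEDist (h p r) Y < _
          rw [Metric.infEDist_zero_of_mem hrY]
          exact ENNReal.inv_pos.2 (by finiteness)⟩
      exact ⟨d, hdD, hd⟩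
    · intro H
      obtain ⟨d, -, -⟩ := H 0
      obtain ⟨r, -, hr⟩ := isCompact_univ.exists_isMinOn ⟨d, Set.mem_univ _⟩
        (hφ p).continuousOn
      refine ⟨r, r.2, (Metric.mem_iff_infEDist_zero_of_closed hY).2 ?_⟩
      by_contra hne
      obtain ⟨k, hk⟩ := ENNReal.exists_inv_nat_lt hne
      obtain ⟨d, -, hd⟩ := H k
      have h1 : Metric.infEDist (h p r) Y ≤ Metric.infEDist (h p d) Y := hr (Set.mem_univ d)
      have h2 : ((k : ℝ≥0∞) + 1)⁻¹ ≤ (k : ℝ≥0∞)⁻¹ := ENNReal.inv_le_inv.2 le_self_add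
      exact absurd (h1.trans_lt (hd.trans_le h2)) hk.not_gt
  rw [heq]
  exact MeasurableSet.iInter fun k => MeasurableSet.biUnion hDc fun d _ =>
    measurableSet_lt (Metric.continuous_infEDist.measurable.comp (hm d)) measurable_const

namespace ControlAffineSystem

variable {n m N : ℕ} {V : Type*} (S : ControlAffineSystem n m V)

theorem continuous_next (x : Fin n → ℝ) (v : V) : Continuous fun u => S.next x u v := by
  unfold next
  fun_prop

theorem next_sum {ι : Type*} {s : Finset ι} {w : ι → ℝ} (hw : ∑ i ∈ s, w i = 1)
    (x : Fin n → ℝ) (u : ι → Fin m → ℝ) (v : V) :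
    S.next x (∑ i ∈ s, w i • u i) v = ∑ i ∈ s, w i • S.next x (u i) v := by
  simp only [next, smul_add, Finset.sum_add_distrib, ← Finset.sum_smul, hw, one_smul,
    Matrix.mulVec_sum, Matrix.mulVec_smul]

theorem next_smul_add_smul (x : Fin n → ℝ) (u u' : Fin m → ℝ) (v : V) (a b : ℝ) (hab : a + b = 1) :
    S.next x (a • u + b • u') v = a • S.next x u v + b • S.next x u' v := by
  have h : S.f x v = a • S.f x v + b • S.f x v := by rw [← add_smul, hab, one_smul]
  simp only [next, Matrix.mulVec_add, Matrix.mulVec_smul, smul_add]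
  nth_rewrite 1 [h]
  abel

theorem measurable_next [MeasurableSpace V] {Ω : Type*} [MeasurableSpace Ω]
    (hf : Measurable fun p : (Fin n → ℝ) × V => S.f p.1 p.2)
    (hg : ∀ a b, Measurable fun p : (Fin n → ℝ) × V => S.g p.1 p.2 a b)
    {x : Ω → Fin n → ℝ} {u : Ω → Fin m → ℝ} {v : Ω → V}
    (hx : Measurable x) (hu : Measurable u) (hv : Measurable v) :
    Measurable fun p => S.next (x p) (u p) (v p) := by
  refine measurable_pi_iff.2 fun a => ?_
  simp only [next, Pi.add_apply, Matrix.mulVec, dotProduct]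
  refine ((measurable_pi_apply a).comp (hf.comp (hx.prodMk hv))).add
    (Finset.measurable_sum _ fun b _ => ?_)
  exact ((hg a b).comp (hx.prodMk hv)).mul ((measurable_pi_apply b).comp hu)

/-- The parameters on a line that are feasible for a single sample. -/
def lineInterval (uhat c : Fin m → ℝ) (x : Fin n → ℝ) (v : V) : Set ℝ :=
  {r | S.next x (uhat + r • c) v ∈ S.stateSet ∧ uhat + r • c ∈ S.inputSet}

theorem lineFeasible_eq_iInter (hN : 0 < N) (uhat c : Fin m → ℝ) (x : Fin n → ℝ)
    (v : Fin N → V) :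
    S.lineFeasible uhat c x v = ⋂ i, S.lineInterval uhat c x (v i) := by
  ext r
  simp only [lineFeasible, lineInterval, Set.mem_ofPred_eq, Set.mem_iInter]
  exact ⟨fun h i => ⟨h.1 i, h.2⟩, fun h => ⟨fun i => (h i).1, (h ⟨0, hN⟩).2⟩⟩

theorem lineInterval_eq_lineFeasible (uhat c : Fin m → ℝ) (x : Fin n → ℝ) (v : V) :
    S.lineInterval uhat c x v = S.lineFeasible uhat c x (fun _ : Fin 1 => v) := by
  simp [lineFeasible_eq_iInter, Set.iInter_const]

theorem convex_lineFeasible (hX : Convex ℝ S.stateSet) (hU : Convex ℝ S.inputSet)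
    (uhat c : Fin m → ℝ) (x : Fin n → ℝ) (v : Fin N → V) :
    Convex ℝ (S.lineFeasible uhat c x v) := by
  intro r hr s hs a b ha hb hab
  have hline : uhat + (a • r + b • s) • c = a • (uhat + r • c) + b • (uhat + s • c) := by
    have h : uhat = a • uhat + b • uhat := by rw [← add_smul, hab, one_smul]
    simp only [smul_add, add_smul, smul_eq_mul, mul_smul]
    nth_rewrite 1 [h]
    abel
  refine ⟨fun i => ?_, ?_⟩
  · rw [hline, next_smul_add_smul _ _ _ _ _ _ _ hab]
    exact hX (hr.1 i) (hs.1 i) ha hb hab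
  · rw [hline]
    exact hU hr.2 hs.2 ha hb hab

theorem isClosed_lineFeasible (hX : IsClosed S.stateSet) (hU : IsClosed S.inputSet)
    (uhat c : Fin m → ℝ) (x : Fin n → ℝ) (v : Fin N → V) :
    IsClosed (S.lineFeasible uhat c x v) := by
  have hline : Continuous fun r : ℝ => uhat + r • c := by fun_prop
  simp only [lineFeasible, Set.ofPred_and, Set.ofPred_forall]
  exact (isClosed_iInter fun i => hX.preimage ((S.continuous_next x (v i)).comp hline)).inter
    (hU.preimage hline)

theorem exists_lineFeasible_subset_Icc (hU : Bornology.IsBounded S.inputSet)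
    (uhat : Fin m → ℝ) {c : Fin m → ℝ} (hc : c ≠ 0) :
    ∃ R : ℝ, ∀ (x : Fin n → ℝ) (N : ℕ) (v : Fin N → V),
      S.lineFeasible uhat c x v ⊆ Set.Icc (-R) R := by
  obtain ⟨C, hC⟩ := hU.exists_norm_le
  refine ⟨(C + ‖uhat‖) / ‖c‖, fun x N v r hr => abs_le.1 ?_⟩
  rw [le_div_iff₀ (norm_pos_iff.2 hc), ← Real.norm_eq_abs, ← norm_smul]
  calc ‖r • c‖ = ‖(uhat + r • c) - uhat‖ := by simp
    _ ≤ ‖uhat + r • c‖ + ‖uhat‖ := norm_sub_le _ _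
    _ ≤ C + ‖uhat‖ := by gcongr; exact hC _ hr.2

theorem isCompact_lineFeasible (hX : IsClosed S.stateSet) (hU : IsCompact S.inputSet)
    (uhat : Fin m → ℝ) {c : Fin m → ℝ} (hc : c ≠ 0) (x : Fin n → ℝ) (v : Fin N → V) :
    IsCompact (S.lineFeasible uhat c x v) := by
  obtain ⟨R, hR⟩ := S.exists_lineFeasible_subset_Icc hU.isBounded uhat hc
  exact isCompact_Icc.of_isClosed_subset (S.isClosed_lineFeasible hX hU.isClosed uhat c x v)
    (hR x N v)

/-- The optimizer along a line, whenever it exists. -/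
noncomputable def lineMax (uhat c : Fin m → ℝ) (x : Fin n → ℝ) (v : Fin N → V) : ℝ :=
  sSup (S.lineFeasible uhat c x v)

variable {S} in
theorem lineMax_eq {uhat c : Fin m → ℝ} {x : Fin n → ℝ} {v : Fin N → V} {r : ℝ}
    (h : IsGreatest (S.lineFeasible uhat c x v) r) : S.lineMax uhat c x v = r :=
  h.csSup_eq

theorem not_isGreatest_lineFeasible_zero (uhat : Fin m → ℝ) (x : Fin n → ℝ)
    (v : Fin N → V) (r : ℝ) : ¬ IsGreatest (S.lineFeasible uhat 0 x v) r := by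
  intro h
  have : r + 1 ∈ S.lineFeasible uhat 0 x v := by
    simpa only [lineFeasible, smul_zero, Set.mem_ofPred_eq] using h.1
  linarith [h.2 this]

/-- For the zero direction the feasible set is empty or all of `ℝ`, and `sSup` takes its default
value 0 on both. -/
theorem lineMax_zero (uhat : Fin m → ℝ) (x : Fin n → ℝ) (v : Fin N → V) :
    S.lineMax uhat 0 x v = 0 := by
  rw [lineMax]
  rcases (S.lineFeasible uhat 0 x v).eq_empty_or_nonempty with h | ⟨r, hr⟩
  · rw [h, Real.sSup_empty]
  · rw [Set.eq_univ_of_forall (s := S.lineFeasible uhat 0 x v) fun s => by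
      simpa only [lineFeasible, smul_zero, Set.mem_ofPred_eq] using hr, Real.sSup_univ]

theorem isGreatest_lineMax_iff (hX : IsClosed S.stateSet) (hU : IsCompact S.inputSet)
    (uhat : Fin m → ℝ) (c : Fin m → ℝ) (x : Fin n → ℝ) (v : Fin N → V) :
    IsGreatest (S.lineFeasible uhat c x v) (S.lineMax uhat c x v) ↔
      c ≠ 0 ∧ (S.lineFeasible uhat c x v).Nonempty := by
  constructor
  · intro h
    refine ⟨?_, h.nonempty⟩
    rintro rfl
    exact S.not_isGreatest_lineFeasible_zero _ _ _ _ h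
  · rintro ⟨hc, hne⟩
    exact (S.isCompact_lineFeasible hX hU uhat hc x v).isGreatest_sSup hne

section Measurability

variable [MeasurableSpace V] {Ω : Type*} [MeasurableSpace Ω]
  {x : Ω → Fin n → ℝ} {v : Ω → Fin N → V}

theorem measurableSet_exists_lineFeasible
    (hf : Measurable fun p : (Fin n → ℝ) × V => S.f p.1 p.2)
    (hg : ∀ a b, Measurable fun p : (Fin n → ℝ) × V => S.g p.1 p.2 a b)
    (hX : IsClosed S.stateSet) (hU : IsClosed S.inputSet) (uhat c : Fin m → ℝ)
    (hx : Measurable x) (hv : Measurable v) (s t : ℝ) :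
    MeasurableSet {p | ∃ r ∈ Set.Icc s t, r ∈ S.lineFeasible uhat c (x p) (v p)} := by
  have := measurableSet_exists_mem_Icc
    (h := fun p r => ((fun i => S.next (x p) (uhat + r • c) (v p i)), uhat + r • c))
    (Y := (Set.univ.pi fun _ : Fin N => S.stateSet) ×ˢ S.inputSet)
    (fun r => (measurable_pi_iff.2 fun i => S.measurable_next hf hg hx measurable_const
      ((measurable_pi_apply i).comp hv)).prodMk measurable_const)
    (fun p => (continuous_pi fun i => (S.continuous_next (x p) (v p i)).comp
      (by fun_prop : Continuous fun r : ℝ => uhat + r • c)).prodMk (by fun_prop))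
    ((isClosed_set_pi fun _ _ => hX).prod hU) s t
  simpa [lineFeasible] using this

theorem measurableSet_lineFeasible_nonempty
    (hf : Measurable fun p : (Fin n → ℝ) × V => S.f p.1 p.2)
    (hg : ∀ a b, Measurable fun p : (Fin n → ℝ) × V => S.g p.1 p.2 a b)
    (hX : IsClosed S.stateSet) (hU : IsCompact S.inputSet) (uhat : Fin m → ℝ) {c : Fin m → ℝ}
    (hc : c ≠ 0) (hx : Measurable x) (hv : Measurable v) :
    MeasurableSet {p | (S.lineFeasible uhat c (x p) (v p)).Nonempty} := by
  obtain ⟨R, hR⟩ := S.exists_lineFeasible_subset_Icc hU.isBounded uhat hc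
  convert S.measurableSet_exists_lineFeasible hf hg hX hU.isClosed uhat c hx hv (-R) R using 3
  exact ⟨fun ⟨r, hr⟩ => ⟨r, hR _ _ _ hr, hr⟩, fun ⟨r, _, hr⟩ => ⟨r, hr⟩⟩

theorem measurable_lineMax
    (hf : Measurable fun p : (Fin n → ℝ) × V => S.f p.1 p.2)
    (hg : ∀ a b, Measurable fun p : (Fin n → ℝ) × V => S.g p.1 p.2 a b)
    (hX : IsClosed S.stateSet) (hU : IsCompact S.inputSet) (uhat c : Fin m → ℝ)
    (hx : Measurable x) (hv : Measurable v) :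
    Measurable fun p => S.lineMax uhat c (x p) (v p) := by
  by_cases hc : c = 0
  · simp only [hc, lineMax_zero, measurable_const]
  obtain ⟨R, hR⟩ := S.exists_lineFeasible_subset_Icc hU.isBounded uhat hc
  refine measurable_of_Ici fun s => ?_
  -- The second set accounts for infeasible programs, where `sSup ∅ = 0`.
  have heq : (fun p => S.lineMax uhat c (x p) (v p)) ⁻¹' Set.Ici s =
      {p | ∃ r ∈ Set.Icc s R, r ∈ S.lineFeasible uhat c (x p) (v p)} ∪
      ({p | (S.lineFeasible uhat c (x p) (v p)).Nonempty}ᶜ ∩ {_p | s ≤ 0}) := by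
    ext p
    simp only [Set.mem_preimage, Set.mem_Ici, Set.mem_union, Set.mem_ofPred_eq, Set.mem_inter_iff,
      Set.mem_compl_iff]
    by_cases hne : (S.lineFeasible uhat c (x p) (v p)).Nonempty
    · have hmax := (S.isGreatest_lineMax_iff hX hU uhat c (x p) (v p)).2 ⟨hc, hne⟩
      simp only [hne, not_true_eq_false, false_and, or_false]
      exact ⟨fun h => ⟨_, ⟨h, (hR _ _ _ hmax.1).2⟩, hmax.1⟩, fun ⟨r, hr, hrF⟩ =>
        hr.1.trans (hmax.2 hrF)⟩
    · have h0 : S.lineMax uhat c (x p) (v p) = 0 := by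
        rw [lineMax, Set.not_nonempty_iff_eq_empty.1 hne, Real.sSup_empty]
      simp only [h0, hne, not_false_eq_true, true_and]
      exact ⟨Or.inr, fun h => h.resolve_left fun ⟨r, _, hr⟩ => hne ⟨r, hr⟩⟩
  rw [heq]
  exact (S.measurableSet_exists_lineFeasible hf hg hX hU.isClosed uhat c hx hv s R).union
    ((S.measurableSet_lineFeasible_nonempty hf hg hX hU uhat hc hx hv).compl.inter
      (MeasurableSet.const _))

theorem measurableSet_isGreatest_lineMax
    (hf : Measurable fun p : (Fin n → ℝ) × V => S.f p.1 p.2)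
    (hg : ∀ a b, Measurable fun p : (Fin n → ℝ) × V => S.g p.1 p.2 a b)
    (hX : IsClosed S.stateSet) (hU : IsCompact S.inputSet) (uhat c : Fin m → ℝ)
    (hx : Measurable x) (hv : Measurable v) :
    MeasurableSet {p | IsGreatest (S.lineFeasible uhat c (x p) (v p))
      (S.lineMax uhat c (x p) (v p))} := by
  simp only [S.isGreatest_lineMax_iff hX hU]
  by_cases hc : c = 0
  · simp [hc]
  · simpa [hc] using S.measurableSet_lineFeasible_nonempty hf hg hX hU uhat hc hx hv

end Measurability

end ControlAffineSystem

/-! ### Violation probability of the hull -/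

/-- The face of the standard simplex whose points are supported in `J`. -/
def simplexFace {M : ℕ} (J : Finset (Fin M)) : Set (Fin M → ℝ) :=
  {w | w ∈ stdSimplex ℝ (Fin M) ∧ ∀ j ∉ J, w j = 0}

theorem sum_eq_one_of_mem_simplexFace {M : ℕ} {J : Finset (Fin M)} {w : Fin M → ℝ}
    (hw : w ∈ simplexFace J) : ∑ j ∈ J, w j = 1 := by
  rw [← hw.1.2]
  exact Finset.sum_subset (Finset.subset_univ J) fun j _ hj => hw.2 j hj

theorem convexHull_image_eq_image_simplexFace {M : ℕ} {E : Type*} [AddCommGroup E] [Module ℝ E]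
    (J : Finset (Fin M)) (p : Fin M → E) :
    convexHull ℝ (p '' J) = (fun w => ∑ j ∈ J, w j • p j) '' simplexFace J := by
  refine Set.Subset.antisymm (convexHull_min ?_ ?_) ?_
  · rintro _ ⟨j, hj, rfl⟩
    refine ⟨Pi.single j 1, ⟨single_mem_stdSimplex ℝ j, fun i hi => ?_⟩, ?_⟩
    · exact Pi.single_eq_of_ne (by rintro rfl; exact hi hj) 1
    · dsimp only
      rw [Finset.sum_eq_single_of_mem j hj fun i _ hij => by simp [Pi.single_eq_of_ne hij]]
      simp
  · rintro _ ⟨w, hw, rfl⟩ _ ⟨w', hw', rfl⟩ a b ha hb hab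
    refine ⟨a • w + b • w', ⟨convex_stdSimplex ℝ _ hw.1 hw'.1 ha hb hab, fun j hj => ?_⟩, ?_⟩
    · simp [hw.2 j hj, hw'.2 j hj]
    · simp [add_smul, Finset.sum_add_distrib, Finset.smul_sum, mul_smul]
  · rintro _ ⟨w, hw, rfl⟩
    exact (convex_convexHull ℝ _).sum_mem (fun j _ => hw.1.1 j)
      (sum_eq_one_of_mem_simplexFace hw)
      fun j hj => subset_convexHull ℝ _ ⟨j, hj, rfl⟩

namespace ControlAffineSystem

variable {n m M N : ℕ} {V : Type*} (S : ControlAffineSystem n m V)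

open Classical in
/-- The lines whose scenario program has an optimizer. -/
noncomputable def activeLines (uhat : Fin m → ℝ) (c : Fin M → Fin m → ℝ) (x : Fin n → ℝ)
    (v : Fin N → V) : Finset (Fin M) :=
  Finset.univ.filter fun j =>
    IsGreatest (S.lineFeasible uhat (c j) x v) (S.lineMax uhat (c j) x v)

theorem mem_activeLines {uhat : Fin m → ℝ} {c : Fin M → Fin m → ℝ} {x : Fin n → ℝ}
    {v : Fin N → V} {j : Fin M} : j ∈ S.activeLines uhat c x v ↔
      IsGreatest (S.lineFeasible uhat (c j) x v) (S.lineMax uhat (c j) x v) := by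
  simp [activeLines]

theorem hullSet_eq_image (uhat : Fin m → ℝ) (c : Fin M → Fin m → ℝ) (x : Fin n → ℝ)
    (v : Fin N → V) : S.hullSet uhat c x v =
      (fun w => ∑ j ∈ S.activeLines uhat c x v,
        w j • (uhat + S.lineMax uhat (c j) x v • c j)) '' simplexFace (S.activeLines uhat c x v) := by
  rw [← convexHull_image_eq_image_simplexFace, hullSet]
  congr 1
  ext u
  constructor
  · rintro ⟨j, r, hr, rfl⟩
    have := lineMax_eq hr
    exact ⟨j, S.mem_activeLines.2 (this.symm ▸ hr), by simp only [this]⟩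
  · rintro ⟨j, hj, rfl⟩
    exact ⟨j, _, S.mem_activeLines.1 hj, rfl⟩

theorem activeLines_nonempty {uhat : Fin m → ℝ} {c : Fin M → Fin m → ℝ} {x : Fin n → ℝ}
    {v : Fin N → V} (h : (S.hullSet uhat c x v).Nonempty) :
    (S.activeLines uhat c x v).Nonempty := by
  obtain ⟨_, hu⟩ := convexHull_nonempty_iff.1 h
  obtain ⟨j, r, hr, -⟩ := hu
  exact ⟨j, S.mem_activeLines.2 ((lineMax_eq hr).symm ▸ hr)⟩

variable [MeasurableSpace V]

/-- Lower semicontinuity of the violation probability in the input, along sequences. -/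
theorem measure_next_notMem_le_iSup (P : Measure V) (hX : IsClosed S.stateSet) (x : Fin n → ℝ)
    {u : Fin m → ℝ} {w : ℕ → Fin m → ℝ} (hw : Filter.Tendsto w Filter.atTop (nhds u)) :
    P {v | S.next x u v ∉ S.stateSet} ≤ ⨆ k, P {v | S.next x (w k) v ∉ S.stateSet} := by
  have hsub : {v | S.next x u v ∉ S.stateSet} ⊆
      ⋃ k, {v | ∀ l ≥ k, S.next x (w l) v ∉ S.stateSet} := by
    intro v hv
    have h := (((S.continuous_next x v).tendsto u).comp hw).eventually
      (hX.isOpen_compl.mem_nhds hv)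
    obtain ⟨k, hk⟩ := Filter.eventually_atTop.1 h
    exact Set.mem_iUnion.2 ⟨k, hk⟩
  refine (measure_mono hsub).trans ?_
  have hmono : Monotone fun k => {v | ∀ l ≥ k, S.next x (w l) v ∉ S.stateSet} :=
    fun k k' hkk' v hv l hl => Set.mem_ofPred.1 hv l (hkk'.trans hl)
  rw [hmono.measure_iUnion]
  exact iSup_mono fun k => measure_mono fun v hv => Set.mem_ofPred.1 hv k le_rfl

theorem measurable_measure_next_notMem (P : Measure V) [IsProbabilityMeasure P]
    (hf : Measurable fun p : (Fin n → ℝ) × V => S.f p.1 p.2)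
    (hg : ∀ a b, Measurable fun p : (Fin n → ℝ) × V => S.g p.1 p.2 a b)
    (hX : IsClosed S.stateSet) {Ω : Type*} [MeasurableSpace Ω]
    {x : Ω → Fin n → ℝ} {u : Ω → Fin m → ℝ} (hx : Measurable x) (hu : Measurable u) :
    Measurable fun p => P {v | S.next (x p) (u p) v ∉ S.stateSet} := by
  have : MeasurableSet {q : Ω × V | S.next (x q.1) (u q.1) q.2 ∉ S.stateSet} :=
    (S.measurable_next hf hg (hx.comp measurable_fst) (hu.comp measurable_fst) measurable_snd)
      hX.measurableSet.compl
  exact measurable_measure_prodMk_left (ν := P) this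

open Classical in
/-- The violation probability of the optimizer along a line, zero if there is none. -/
noncomputable def lineViolation (P : Measure V) (uhat c : Fin m → ℝ) (x : Fin n → ℝ)
    (v : Fin N → V) : ℝ≥0∞ :=
  if IsGreatest (S.lineFeasible uhat c x v) (S.lineMax uhat c x v) then
    P {v' | S.next x (uhat + S.lineMax uhat c x v • c) v' ∉ S.stateSet}
  else 0

theorem firstStageViolation_hullSet_le_sum (P : Measure V) (hX : Convex ℝ S.stateSet)
    (uhat : Fin m → ℝ) (c : Fin M → Fin m → ℝ) (x : Fin n → ℝ) (v : Fin N → V) :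
    S.firstStageViolation P x (S.hullSet uhat c x v) ≤
      ∑ j, S.lineViolation P uhat (c j) x v := by
  rw [hullSet_eq_image, firstStageViolation, iSup_image]
  refine iSup₂_le fun w hw => ?_
  have hsub : {v' | S.next x (∑ j ∈ S.activeLines uhat c x v,
        w j • (uhat + S.lineMax uhat (c j) x v • c j)) v' ∉ S.stateSet} ⊆
      ⋃ j ∈ S.activeLines uhat c x v,
        {v' | S.next x (uhat + S.lineMax uhat (c j) x v • c j) v' ∉ S.stateSet} := by
    intro v' hv'
    by_contra hcon
    simp only [Set.mem_iUnion, Set.mem_ofPred_eq, not_exists, not_not] at hcon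
    refine hv' ?_
    rw [S.next_sum (sum_eq_one_of_mem_simplexFace hw)]
    exact hX.sum_mem (fun j _ => hw.1.1 j) (sum_eq_one_of_mem_simplexFace hw) hcon
  refine (measure_mono hsub).trans ((measure_biUnion_finset_le _ _).trans ?_)
  refine le_trans (Finset.sum_le_sum fun j hj => ?_)
    (Finset.sum_le_sum_of_subset (Finset.subset_univ _))
  rw [lineViolation, if_pos (S.mem_activeLines.1 hj)]

/-- Once the set `J` of active lines is fixed, the hull is the image of a simplex face that does not
depend on the sample. Violation is lower semicontinuous in the input, so a countable dense set of
weights gives the same supremum. -/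
theorem measurable_firstStageViolation_hullSet (P : Measure V) [IsProbabilityMeasure P]
    (hf : Measurable fun p : (Fin n → ℝ) × V => S.f p.1 p.2)
    (hg : ∀ a b, Measurable fun p : (Fin n → ℝ) × V => S.g p.1 p.2 a b)
    (hX : IsClosed S.stateSet) (hU : IsCompact S.inputSet)
    (uhat : Fin m → ℝ) (c : Fin M → Fin m → ℝ) :
    Measurable fun p : (Fin n → ℝ) × (Fin N → V) =>
      S.firstStageViolation P p.1 (S.hullSet uhat c p.1 p.2) := by
  choose D hDc hDd using fun J : Finset (Fin M) =>
    TopologicalSpace.exists_countable_dense (simplexFace J)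
  have heq : (fun p : (Fin n → ℝ) × (Fin N → V) =>
      S.firstStageViolation P p.1 (S.hullSet uhat c p.1 p.2)) =
      fun p => ⨆ J : Finset (Fin M), ⨆ w ∈ D J,
        {p : (Fin n → ℝ) × (Fin N → V) | ∀ j, j ∈ J ↔
          IsGreatest (S.lineFeasible uhat (c j) p.1 p.2) (S.lineMax uhat (c j) p.1 p.2)}.indicator
        (fun p => P {v' | S.next p.1 (∑ j ∈ J,
          (w : Fin M → ℝ) j • (uhat + S.lineMax uhat (c j) p.1 p.2 • c j)) v' ∉ S.stateSet}) p := by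
    funext p
    rw [hullSet_eq_image, firstStageViolation, iSup_image]
    apply le_antisymm
    · refine iSup₂_le fun w hw => ?_
      refine le_trans ?_ (le_iSup _ (S.activeLines uhat c p.1 p.2))
      obtain ⟨z, hzD, hz⟩ := mem_closure_iff_seq_limit.1
        (hDd (S.activeLines uhat c p.1 p.2) ⟨w, hw⟩)
      have hlim : Filter.Tendsto (fun k => ∑ j ∈ S.activeLines uhat c p.1 p.2,
          (z k : Fin M → ℝ) j • (uhat + S.lineMax uhat (c j) p.1 p.2 • c j)) Filter.atTop
          (nhds (∑ j ∈ S.activeLines uhat c p.1 p.2,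
            w j • (uhat + S.lineMax uhat (c j) p.1 p.2 • c j))) := by
        have hcont : Continuous fun y : simplexFace (S.activeLines uhat c p.1 p.2) =>
            ∑ j ∈ S.activeLines uhat c p.1 p.2,
              (y : Fin M → ℝ) j • (uhat + S.lineMax uhat (c j) p.1 p.2 • c j) := by
          exact continuous_finsetSum _ fun j _ =>
            ((continuous_apply j).comp continuous_subtype_val).smul continuous_const
        exact (hcont.tendsto _).comp hz
      refine (S.measure_next_notMem_le_iSup P hX p.1 hlim).trans (iSup_le fun k => ?_)
      refine le_trans ?_ (le_iSup₂ (z k) (hzD k))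
      rw [Set.indicator_of_mem]
      exact fun j => S.mem_activeLines
    · refine iSup_le fun J => iSup₂_le fun w _ => ?_
      by_cases hJ : ∀ j, j ∈ J ↔
          IsGreatest (S.lineFeasible uhat (c j) p.1 p.2) (S.lineMax uhat (c j) p.1 p.2)
      · obtain rfl : J = S.activeLines uhat c p.1 p.2 := by
          ext j
          rw [hJ, S.mem_activeLines]
        rw [Set.indicator_of_mem (by exact hJ)]
        exact le_iSup₂_of_le (w : Fin M → ℝ) w.2 le_rfl
      · rw [Set.indicator_of_notMem (by exact hJ)]
        exact zero_le
  rw [heq]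
  refine Measurable.iSup fun J => Measurable.biSup _ (hDc J) fun w _ => ?_
  refine (S.measurable_measure_next_notMem P hf hg hX measurable_fst ?_).indicator ?_
  · refine Finset.measurable_sum _ fun j _ => Measurable.fun_const_smul ?_ _
    exact measurable_const.add
      ((S.measurable_lineMax hf hg hX hU uhat (c j) measurable_fst measurable_snd).smul_const _)
  · simp only [Set.ofPred_forall]
    exact MeasurableSet.iInter fun j => MeasurableSet.iff (MeasurableSet.const _)
      (S.measurableSet_isGreatest_lineMax hf hg hX hU uhat (c j) measurable_fst measurable_snd)

theorem measurable_lineViolation (P : Measure V) [IsProbabilityMeasure P]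
    (hf : Measurable fun p : (Fin n → ℝ) × V => S.f p.1 p.2)
    (hg : ∀ a b, Measurable fun p : (Fin n → ℝ) × V => S.g p.1 p.2 a b)
    (hX : IsClosed S.stateSet) (hU : IsCompact S.inputSet) (uhat c : Fin m → ℝ)
    (x : Fin n → ℝ) : Measurable fun v : Fin N → V => S.lineViolation P uhat c x v := by
  unfold lineViolation
  exact Measurable.ite
    (S.measurableSet_isGreatest_lineMax hf hg hX hU uhat c measurable_const measurable_id)
    (S.measurable_measure_next_notMem P hf hg hX measurable_const (measurable_const.add
      ((S.measurable_lineMax hf hg hX hU uhat c measurable_const measurable_id).smul_const _)))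
    measurable_const

end ControlAffineSystem

/-! ### Exchangeability: expected violation as a count of removals -/

section Removal

variable {N : ℕ} {V : Type*} [MeasurableSpace V] (P : Measure V) [IsProbabilityMeasure P]

/-- A finite product probability measure is the law of an independent coordinate and the rest. -/
theorem measurePreserving_removal (i : Fin (N + 1)) :
    MeasurePreserving (fun w : Fin (N + 1) → V => (w i, fun k : Fin N => w (i.succAbove k)))
      (Measure.pi fun _ : Fin (N + 1) => P) (P.prod (Measure.pi fun _ : Fin N => P)) :=
  measurePreserving_piFinSuccAbove (fun _ : Fin (N + 1) => P) i

theorem ae_forall_removal {Q : (Fin N → V) → Prop}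
    (h : ∀ᵐ v ∂(Measure.pi fun _ : Fin N => P), Q v) :
    ∀ᵐ w ∂(Measure.pi fun _ : Fin (N + 1) => P),
      ∀ i : Fin (N + 1), Q fun k => w (i.succAbove k) :=
  ae_all_iff.2 fun i => (measurePreserving_snd.comp
    (measurePreserving_removal P i)).quasiMeasurePreserving.ae h

end Removal

namespace ControlAffineSystem

variable {n m M N : ℕ} {V : Type*} (S : ControlAffineSystem n m V)

/-- The input constraint does not involve the sample and the optimizer already satisfies it, so the
removed sample can reject only through the state constraint. -/
theorem removalViolates_lineInterval_iff (hN : 0 < N) (uhat c : Fin m → ℝ) (x : Fin n → ℝ)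
    (w : Fin (N + 1) → V) (i : Fin (N + 1)) :
    RemovalViolates (fun k => S.lineInterval uhat c x (w k)) i ↔
      IsGreatest (S.lineFeasible uhat c x fun k => w (i.succAbove k))
        (S.lineMax uhat c x fun k => w (i.succAbove k)) ∧
      S.next x (uhat + (S.lineMax uhat c x fun k => w (i.succAbove k)) • c) (w i)
        ∉ S.stateSet := by
  rw [RemovalViolates, ← S.lineFeasible_eq_iInter hN uhat c x fun k => w (i.succAbove k)]
  constructor
  · rintro ⟨r, hr, hri⟩
    rw [lineMax_eq hr]
    exact ⟨hr, fun h => hri ⟨h, hr.1.2⟩⟩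
  · rintro ⟨hr, hri⟩
    exact ⟨_, hr, fun h => hri h.1⟩

theorem convex_lineInterval (hX : Convex ℝ S.stateSet) (hU : Convex ℝ S.inputSet)
    (uhat c : Fin m → ℝ) (x : Fin n → ℝ) (v : V) : Convex ℝ (S.lineInterval uhat c x v) := by
  rw [lineInterval_eq_lineFeasible]
  exact S.convex_lineFeasible hX hU _ _ _ _

variable [MeasurableSpace V] (P : Measure V) [IsProbabilityMeasure P]

theorem measurableSet_lineMax_violated
    (hf : Measurable fun p : (Fin n → ℝ) × V => S.f p.1 p.2)
    (hg : ∀ a b, Measurable fun p : (Fin n → ℝ) × V => S.g p.1 p.2 a b)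
    (hX : IsClosed S.stateSet) (hU : IsCompact S.inputSet) (uhat c : Fin m → ℝ)
    (x : Fin n → ℝ) :
    MeasurableSet {q : V × (Fin N → V) |
      IsGreatest (S.lineFeasible uhat c x q.2) (S.lineMax uhat c x q.2) ∧
      S.next x (uhat + S.lineMax uhat c x q.2 • c) q.1 ∉ S.stateSet} := by
  refine (S.measurableSet_isGreatest_lineMax hf hg hX hU uhat c measurable_const
    measurable_snd).inter ?_
  exact (S.measurable_next hf hg measurable_const (measurable_const.add
    ((S.measurable_lineMax hf hg hX hU uhat c measurable_const measurable_snd).smul_const _))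
    measurable_fst) hX.measurableSet.compl

theorem measurableSet_removalViolates (hN : 0 < N)
    (hf : Measurable fun p : (Fin n → ℝ) × V => S.f p.1 p.2)
    (hg : ∀ a b, Measurable fun p : (Fin n → ℝ) × V => S.g p.1 p.2 a b)
    (hX : IsClosed S.stateSet) (hU : IsCompact S.inputSet) (uhat c : Fin m → ℝ)
    (x : Fin n → ℝ) (i : Fin (N + 1)) :
    MeasurableSet {w : Fin (N + 1) → V |
      RemovalViolates (fun k => S.lineInterval uhat c x (w k)) i} := by
  simp only [S.removalViolates_lineInterval_iff hN]
  exact (by fun_prop : Measurable fun w : Fin (N + 1) → V => (w i, fun k : Fin N =>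
    w (i.succAbove k))) (S.measurableSet_lineMax_violated hf hg hX hU uhat c x)

/-- The expected violation of the optimizer for `N` samples is the probability that it is violated
by a further sample. -/
theorem lintegral_lineViolation (hN : 0 < N)
    (hf : Measurable fun p : (Fin n → ℝ) × V => S.f p.1 p.2)
    (hg : ∀ a b, Measurable fun p : (Fin n → ℝ) × V => S.g p.1 p.2 a b)
    (hX : IsClosed S.stateSet) (hU : IsCompact S.inputSet) (uhat c : Fin m → ℝ)
    (x : Fin n → ℝ) (i : Fin (N + 1)) :
    ∫⁻ v, S.lineViolation P uhat c x v ∂(Measure.pi fun _ : Fin N => P) =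
      (Measure.pi fun _ : Fin (N + 1) => P)
        {w | RemovalViolates (fun k => S.lineInterval uhat c x (w k)) i} := by
  have hT := S.measurableSet_lineMax_violated (N := N) hf hg hX hU uhat c x
  simp only [S.removalViolates_lineInterval_iff hN]
  have := (measurePreserving_removal P i).measure_preimage hT.nullMeasurableSet
  refine Eq.trans ?_ this.symm
  rw [Measure.prod_apply_symm hT]
  refine lintegral_congr fun v => ?_
  rw [lineViolation]
  split_ifs with h
  · congr 1
    ext v'
    simp [h]
  · simp [h]

open Classical in
theorem sum_lintegral_lineViolation_le (hN : 0 < N)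
    (hf : Measurable fun p : (Fin n → ℝ) × V => S.f p.1 p.2)
    (hg : ∀ a b, Measurable fun p : (Fin n → ℝ) × V => S.g p.1 p.2 a b)
    (hX : IsClosed S.stateSet) (hU : IsCompact S.inputSet) (uhat : Fin m → ℝ)
    (c : Fin M → Fin m → ℝ) (x : Fin n → ℝ) {C : ℕ}
    (hC : ∀ᵐ w ∂(Measure.pi fun _ : Fin (N + 1) => P),
      ∑ j, (Finset.univ.filter
        (RemovalViolates fun k => S.lineInterval uhat (c j) x (w k))).card ≤ C) :
    ∑ j, ∫⁻ v, S.lineViolation P uhat (c j) x v ∂(Measure.pi fun _ : Fin N => P) ≤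
      C / (N + 1 : ℕ) := by
  rw [ENNReal.le_div_iff_mul_le (Or.inl (by simp)) (Or.inl (by simp)), Finset.sum_mul]
  have hcard : ∀ (j : Fin M) (w : Fin (N + 1) → V), ((Finset.univ.filter
      (RemovalViolates fun k => S.lineInterval uhat (c j) x (w k))).card : ℝ≥0∞) =
      ∑ i, {w : Fin (N + 1) → V |
        RemovalViolates (fun k => S.lineInterval uhat (c j) x (w k)) i}.indicator 1 w := by
    intro j w
    simp [Set.indicator_apply]
  have hterm : ∀ j, (∫⁻ v, S.lineViolation P uhat (c j) x v ∂(Measure.pi fun _ : Fin N => P)) *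
      ((N + 1 : ℕ) : ℝ≥0∞) = ∫⁻ w, ((Finset.univ.filter
        (RemovalViolates fun k => S.lineInterval uhat (c j) x (w k))).card : ℝ≥0∞)
        ∂(Measure.pi fun _ : Fin (N + 1) => P) := by
    intro j
    simp only [hcard j]
    rw [lintegral_finsetSum _ fun i _ => measurable_one.indicator
      (S.measurableSet_removalViolates hN hf hg hX hU uhat (c j) x i)]
    simp only [lintegral_indicator_one
      (S.measurableSet_removalViolates hN hf hg hX hU uhat (c j) x _),
      ← S.lintegral_lineViolation P hN hf hg hX hU uhat (c j) x]
    simp [mul_comm]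
  simp only [hterm]
  have hmeas : ∀ j, Measurable fun w : Fin (N + 1) → V => ((Finset.univ.filter
      (RemovalViolates fun k => S.lineInterval uhat (c j) x (w k))).card : ℝ≥0∞) := by
    intro j
    simp only [hcard j]
    exact Finset.measurable_sum _ fun i _ => measurable_one.indicator
      (S.measurableSet_removalViolates hN hf hg hX hU uhat (c j) x i)
  rw [← lintegral_finsetSum _ fun j _ => hmeas j]
  refine (lintegral_mono_ae (hC.mono fun w hw => ?_)).trans
    (b := ∫⁻ _, (C : ℝ≥0∞) ∂(Measure.pi fun _ : Fin (N + 1) => P)) (by simp)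
  exact_mod_cast hw

theorem one_sub_mul_sq_le {q : ℝ≥0∞} (hq : q ≤ 1) : (1 - q) * q ^ 2 ≤ 4 / 27 := by
  lift q to NNReal using ne_top_of_le_ne_top ENNReal.one_ne_top hq
  have hq' : q ≤ 1 := by exact_mod_cast hq
  have h27 : (4 / 27 : ℝ≥0∞) = ((4 / 27 : NNReal) : ℝ≥0∞) := by
    rw [ENNReal.coe_div (by norm_num)]; norm_num
  rw [h27]
  norm_cast
  rw [← NNReal.coe_le_coe, NNReal.coe_mul, NNReal.coe_sub hq']
  push_cast
  have h0 : (0 : ℝ) ≤ q := q.2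
  -- `4/27 - (1 - q) q² = (q - 2/3)² (q + 1/3)`.
  nlinarith [mul_nonneg (sq_nonneg ((q : ℝ) - 2 / 3)) (by linarith : (0 : ℝ) ≤ q + 1 / 3)]

/-- With three samples the expected violation along a line is at most `4 / 9`. -/
theorem lintegral_lineViolation_three_le
    (hf : Measurable fun p : (Fin n → ℝ) × V => S.f p.1 p.2)
    (hg : ∀ a b, Measurable fun p : (Fin n → ℝ) × V => S.g p.1 p.2 a b)
    (hX : IsClosed S.stateSet) (hXc : Convex ℝ S.stateSet)
    (hU : IsCompact S.inputSet) (hUc : Convex ℝ S.inputSet) (uhat c : Fin m → ℝ)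
    (x : Fin n → ℝ) :
    ∫⁻ v, S.lineViolation P uhat c x v ∂(Measure.pi fun _ : Fin 3 => P) ≤ 4 / 9 := by
  let b : V → ℝ := fun v => S.lineMax uhat c x fun _ : Fin 1 => v
  have hb : Measurable b := S.measurable_lineMax hf hg hX hU uhat c measurable_const
    (measurable_pi_iff.2 fun _ => measurable_id)
  -- The optimizer for three samples is the right endpoint `b` of one of them, accepted by the other
  -- two. With `q v` the probability that a fresh sample accepts `b v`, each choice of that sample
  -- contributes at most the mean of `(1 - q) q²`.
  let good : Set (V × V) := {p | b p.1 ∈ S.lineInterval uhat c x p.2}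
  have hline : Measurable fun p : V × V => uhat + b p.1 • c :=
    measurable_const.add ((hb.comp measurable_fst).smul_const _)
  have hgood : MeasurableSet good :=
    ((S.measurable_next hf hg measurable_const hline measurable_snd) hX.measurableSet).inter
      (hline hU.measurableSet)
  let q : V → ℝ≥0∞ := fun v => P (Prod.mk v ⁻¹' good)
  have hq : Measurable q := measurable_measure_prodMk_left hgood
  let G : V × (Fin 2 → V) → ℝ≥0∞ := fun p =>
    {p : V × (Fin 2 → V) | ∀ k, (p.1, p.2 k) ∈ good}.indicator (fun p => 1 - q p.1) p
  have hGs : MeasurableSet {p : V × (Fin 2 → V) | ∀ k, (p.1, p.2 k) ∈ good} := by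
    simp only [Set.ofPred_forall]
    exact MeasurableSet.iInter fun k => (measurable_fst.prodMk
      ((measurable_pi_apply k).comp measurable_snd)) hgood
  have hG : Measurable G := (measurable_const.sub (hq.comp measurable_fst)).indicator hGs
  have hpt : ∀ v : Fin 3 → V, S.lineViolation P uhat c x v ≤
      ∑ i : Fin 3, G (v i, fun k => v (i.succAbove k)) := by
    intro v
    rw [lineViolation]
    split_ifs with h
    swap
    · exact zero_le
    have hc : c ≠ 0 := ((S.isGreatest_lineMax_iff hX hU uhat c x v).1 h).1
    set r := S.lineMax uhat c x v
    rw [S.lineFeasible_eq_iInter (by norm_num)] at h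
    obtain ⟨i, hi⟩ := exists_isGreatest_of_isGreatest_iInter
      (fun i => S.convex_lineInterval hXc hUc uhat c x (v i))
      (fun i => by
        rw [lineInterval_eq_lineFeasible]
        exact S.isCompact_lineFeasible hX hU uhat hc x _) h
    have hbi : b (v i) = r := by
      rw [lineInterval_eq_lineFeasible] at hi
      exact lineMax_eq hi
    refine le_trans ?_ (Finset.single_le_sum (f := fun i => G (v i, fun k => v (i.succAbove k)))
      (fun _ _ => zero_le) (Finset.mem_univ i))
    have hmem : (v i, fun k => v (i.succAbove k)) ∈
        {p : V × (Fin 2 → V) | ∀ k, (p.1, p.2 k) ∈ good} := by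
      intro k
      change b (v i) ∈ S.lineInterval uhat c x (v (i.succAbove k))
      rw [hbi]
      exact Set.mem_iInter.1 h.1 (i.succAbove k)
    dsimp only [G]
    rw [Set.indicator_of_mem hmem]
    dsimp only [q]
    rw [← prob_compl_eq_one_sub (measurable_prodMk_left hgood)]
    refine measure_mono fun v' hv' hg' => hv' ?_
    have := (hg' : b (v i) ∈ S.lineInterval uhat c x v').1
    rwa [hbi] at this
  have hone : ∀ i : Fin 3, ∫⁻ v, G (v i, fun k => v (i.succAbove k))
      ∂(Measure.pi fun _ : Fin 3 => P) ≤ 4 / 27 := by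
    intro i
    rw [(measurePreserving_removal P i).lintegral_comp hG, lintegral_prod _ hG.aemeasurable]
    refine (lintegral_mono fun v => ?_).trans (b := ∫⁻ _, (4 / 27 : ℝ≥0∞) ∂P) (by simp)
    have hslice : ∀ y : Fin 2 → V, G (v, y) =
        (Set.univ.pi fun _ : Fin 2 => Prod.mk v ⁻¹' good).indicator (fun _ => 1 - q v) y := by
      intro y
      classical
      simp only [G, Set.indicator_apply, Set.mem_ofPred_eq, Set.mem_pi, Set.mem_univ,
        true_imp_iff, Set.mem_preimage]
    simp only [hslice]
    rw [lintegral_indicator_const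
      (MeasurableSet.univ_pi fun _ => measurable_prodMk_left hgood), Measure.pi_pi]
    simpa [q] using one_sub_mul_sq_le (q := q v) prob_le_one
  calc ∫⁻ v, S.lineViolation P uhat c x v ∂(Measure.pi fun _ : Fin 3 => P)
      ≤ ∫⁻ v, ∑ i : Fin 3, G (v i, fun k => v (i.succAbove k))
        ∂(Measure.pi fun _ : Fin 3 => P) := lintegral_mono hpt
    _ = ∑ i : Fin 3, ∫⁻ v, G (v i, fun k => v (i.succAbove k))
        ∂(Measure.pi fun _ : Fin 3 => P) :=
      lintegral_finsetSum _ fun i _ => hG.comp (measurePreserving_removal P i).measurable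
    _ ≤ ∑ _i : Fin 3, (4 / 27 : ℝ≥0∞) := Finset.sum_le_sum fun i _ => hone i
    _ = 4 / 9 := by
      rw [Finset.sum_const, Finset.card_univ, Fintype.card_fin, nsmul_eq_mul]
      rw [← ENNReal.toReal_eq_toReal_iff' (by finiteness) (by finiteness)]
      norm_num

end ControlAffineSystem

/-! ### Independence of the closed-loop state and the current samples -/

namespace ControlAffineSystem

variable {n m M N K : ℕ} {V : Type*} (S : ControlAffineSystem n m V)

theorem closedLoop_congr (κ : (Fin n → ℝ) → Scenarios K V → (Fin m → ℝ)) (x : Fin n → ℝ)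
    {ω ω' : ℕ → Scenarios K V × V} {k : ℕ} (h : ∀ i < k, ω i = ω' i) :
    S.closedLoop κ x ω k = S.closedLoop κ x ω' k := by
  induction k with
  | zero => rfl
  | succ k ih =>
    simp only [closedLoop, ih fun i hi => h i (hi.trans k.lt_succ_self), h k k.lt_succ_self]

variable [MeasurableSpace V]

theorem measurable_closedLoop
    (hf : Measurable fun p : (Fin n → ℝ) × V => S.f p.1 p.2)
    (hg : ∀ a b, Measurable fun p : (Fin n → ℝ) × V => S.g p.1 p.2 a b)
    {κ : (Fin n → ℝ) → Scenarios K V → (Fin m → ℝ)}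
    (hκ : Measurable fun p : (Fin n → ℝ) × Scenarios K V => κ p.1 p.2) (x : Fin n → ℝ) (k : ℕ) :
    Measurable fun ω : ℕ → Scenarios K V × V => S.closedLoop κ x ω k := by
  induction k with
  | zero => exact measurable_const
  | succ k ih =>
    simp only [closedLoop]
    exact S.measurable_next hf hg ih (hκ.comp (ih.prodMk (measurable_pi_apply k).fst))
      (measurable_pi_apply k).snd

theorem measurable_firstStageSamples [NeZero K] :
    Measurable fun s : Scenarios K V => firstStageSamples N s :=
  measurable_pi_iff.2 fun i => (measurable_pi_apply (0 : Fin K)).comp (measurable_pi_apply (i : ℕ))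

variable (P : Measure V) [IsProbabilityMeasure P]

theorem map_firstStageSamples [NeZero K] :
    (Measure.infinitePi fun _ : ℕ => Measure.pi fun _ : Fin K => P).map
      (fun s => firstStageSamples N s) = Measure.pi fun _ : Fin N => P := by
  have h1 := Measure.map_infinitePi_infinitePi_of_inj (P := fun _ : ℕ => Measure.pi fun _ : Fin K => P)
    (f := fun i : Fin N => (i : ℕ)) Fin.val_injective
  have h2 := Measure.infinitePi_map_pi (μ := fun _ : Fin N => Measure.pi fun _ : Fin K => P)
    (f := fun _ s => s (0 : Fin K)) fun _ => measurable_pi_apply _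
  have h3 : (Measure.pi fun _ : Fin K => P).map (fun s => s 0) = P :=
    (measurePreserving_eval (fun _ : Fin K => P) 0).map_eq
  rw [← h1, Measure.map_map (by fun_prop) (by fun_prop)] at h2
  simp only [h3, Measure.infinitePi_eq_pi] at h2
  exact h2

/-- At each time, the closed-loop state is independent of the first-stage samples drawn then, and
the latter are independent with law `P`. -/
theorem map_closedLoop_firstStageSamples [NeZero K]
    (hf : Measurable fun p : (Fin n → ℝ) × V => S.f p.1 p.2)
    (hg : ∀ a b, Measurable fun p : (Fin n → ℝ) × V => S.g p.1 p.2 a b)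
    {κ : (Fin n → ℝ) → Scenarios K V → (Fin m → ℝ)}
    (hκ : Measurable fun p : (Fin n → ℝ) × Scenarios K V => κ p.1 p.2) (x : Fin n → ℝ) (k : ℕ) :
    (closedLoopMeasure P K).map
      (fun ω => (S.closedLoop κ x ω k, firstStageSamples N (ω k).1)) =
    ((closedLoopMeasure P K).map fun ω => S.closedLoop κ x ω k).prod
      (Measure.pi fun _ : Fin N => P) := by
  have hprob : IsProbabilityMeasure (closedLoopMeasure P K) := by
    unfold closedLoopMeasure
    infer_instance
  obtain ⟨ω₀⟩ := nonempty_of_isProbabilityMeasure (closedLoopMeasure P K)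
  have hind : ProbabilityTheory.iIndepFun (fun (i : ℕ) (ω : ℕ → Scenarios K V × V) => ω i)
      (closedLoopMeasure P K) :=
    ProbabilityTheory.iIndepFun_infinitePi (X := fun _ s => s) fun _ => measurable_id
  have hpair := hind.indepFun_finset (Finset.range k) {k} (by simp)
    fun i => measurable_pi_apply i
  -- To make the state a function of the draws before time `k` alone, later times are filled with
  -- the fixed trajectory `ω₀`, which does not affect it.
  have hfill : Measurable fun (y : Finset.range k → Scenarios K V × V) (i : ℕ) =>
      if h : i ∈ Finset.range k then y ⟨i, h⟩ else ω₀ i := by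
    refine measurable_pi_iff.2 fun i => ?_
    by_cases h : i ∈ Finset.range k
    · simpa only [h, dif_pos] using measurable_pi_apply _
    · simpa only [h, dif_neg, not_false_eq_true] using measurable_const
  have hcomp := hpair.comp ((S.measurable_closedLoop hf hg hκ x k).comp hfill)
    (ψ := fun y => firstStageSamples N (y ⟨k, Finset.mem_singleton_self k⟩).1)
    (measurable_firstStageSamples.comp (measurable_pi_apply _).fst)
  have hstate : ∀ ω : ℕ → Scenarios K V × V, S.closedLoop κ x (fun i =>
      if _h : i ∈ Finset.range k then ω i else ω₀ i) k = S.closedLoop κ x ω k := fun ω =>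
    S.closedLoop_congr κ x fun i hi => dif_pos (Finset.mem_range.2 hi)
  have hind' : ProbabilityTheory.IndepFun (fun ω => S.closedLoop κ x ω k)
      (fun ω => firstStageSamples N (ω k).1) (closedLoopMeasure P K) := by
    rw [← funext hstate]
    exact hcomp
  have hsamp : Measurable fun ω : ℕ → Scenarios K V × V => firstStageSamples N (ω k).1 :=
    measurable_firstStageSamples.comp (measurable_pi_apply k).fst
  rw [hind'.map_prod_eq_prod_map_map (S.measurable_closedLoop hf hg hκ x k).aemeasurable
    hsamp.aemeasurable]
  congr 1
  have h1 : (closedLoopMeasure P K).map (fun ω => ω k) =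
      (Measure.infinitePi fun _ : ℕ => Measure.pi fun _ : Fin K => P).prod P :=
    Measure.infinitePi_map_eval _ k
  rw [← map_firstStageSamples (K := K) P, ← Measure.fst_prod (ν := P)
    (μ := Measure.infinitePi fun _ : ℕ => Measure.pi fun _ : Fin K => P), ← h1, Measure.fst,
    Measure.map_map measurable_fst (measurable_pi_apply k),
    Measure.map_map measurable_firstStageSamples (measurable_fst.comp (measurable_pi_apply k))]
  rfl

end ControlAffineSystem

/-! ### Evaluation of the admissibility integral -/

theorem integral_mul_binomTail_one (M L N : ℕ) (hL : 0 < L) :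
    ∫ ν in (0 : ℝ)..1, (M : ℝ) * binomTail (ν / (L : ℝ)) 1 N =
      M * (L * (1 - (1 - 1 / (L : ℝ)) ^ (N + 1))) / (N + 1) := by
  have hL' : (L : ℝ) ≠ 0 := by positivity
  have hN' : (N : ℝ) + 1 ≠ 0 := by positivity
  have hderiv : ∀ ν ∈ Set.uIcc (0 : ℝ) 1, HasDerivAt
      (fun ν : ℝ => -(M * L * (1 - ν / L) ^ (N + 1)) / (N + 1))
      ((M : ℝ) * (1 - ν / L) ^ N) ν := by
    intro ν _
    have h0 : HasDerivAt (fun ν : ℝ => 1 - ν / L) (-(1 / L)) ν :=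
      ((hasDerivAt_id ν).div_const (L : ℝ)).const_sub 1
    refine (((h0.fun_pow (N + 1)).const_mul ((M : ℝ) * L)).fun_neg.div_const
      ((N : ℝ) + 1)).congr_deriv ?_
    rw [add_tsub_cancel_right]
    push_cast
    field_simp
  simp only [binomTail, Finset.sum_range_one, Nat.choose_zero_right, pow_zero, Nat.cast_one,
    one_mul, Nat.sub_zero]
  rw [intervalIntegral.integral_eq_sub_of_hasDerivAt hderiv
    (Continuous.intervalIntegrable (by fun_prop) _ _)]
  simp only [zero_div, sub_zero, one_pow]
  ring

theorem one_le_mul_one_sub_pow {L : ℕ} (hL : 0 < L) (N : ℕ) :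
    1 ≤ (L : ℝ) * (1 - (1 - 1 / (L : ℝ)) ^ (N + 1)) := by
  have hL1 : (1 : ℝ) ≤ L := by exact_mod_cast hL
  have h1 : 1 / (L : ℝ) ≤ 1 := by rw [div_le_one (by positivity)]; exact hL1
  have h2 : (1 - 1 / (L : ℝ)) ^ (N + 1) ≤ 1 - 1 / (L : ℝ) :=
    pow_le_of_le_one (by linarith) (by linarith [show 0 ≤ 1 / (L : ℝ) by positivity])
      N.succ_ne_zero
  calc (1 : ℝ) = L * (1 - (1 - 1 / (L : ℝ))) := by field_simp; ring
    _ ≤ _ := by gcongr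

theorem two_le_mul_one_sub_pow {L N : ℕ} (hL : 3 ≤ L) (hN : 2 ≤ N) :
    2 ≤ (L : ℝ) * (1 - (1 - 1 / (L : ℝ)) ^ (N + 1)) := by
  have hL1 : (3 : ℝ) ≤ L := by exact_mod_cast hL
  have h1 : 1 / (L : ℝ) ≤ 1 / 3 := by gcongr
  have h0 : 0 ≤ 1 / (L : ℝ) := by positivity
  have h2 : (1 - 1 / (L : ℝ)) ^ (N + 1) ≤ (1 - 1 / (L : ℝ)) ^ 3 :=
    pow_le_pow_of_le_one (by linarith) (by linarith) (by omega)
  -- Exponent 3 is the worst case `N = 2`; `1/L ≤ 1/3` then suffices.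
  calc (2 : ℝ) ≤ 3 - 3 * (1 / (L : ℝ)) + (1 / (L : ℝ)) ^ 2 := by nlinarith
    _ = L * (1 - (1 - 1 / (L : ℝ)) ^ 3) := by field_simp; ring
    _ ≤ _ := by gcongr

theorem natCast_div_le_ofReal {C N : ℕ} {B : ℝ} (h : (C : ℝ) ≤ B) :
    (C : ℝ≥0∞) / (N + 1 : ℕ) ≤ ENNReal.ofReal (B / (N + 1)) := by
  have : (C : ℝ≥0∞) / (N + 1 : ℕ) = ENNReal.ofReal ((C : ℝ) / (N + 1)) := by
    rw [ENNReal.ofReal_div_of_pos (by positivity), ENNReal.ofReal_natCast]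
    congr 1
    rw [← Nat.cast_add_one, ENNReal.ofReal_natCast]
  rw [this]
  gcongr

/-! ### The bound at a fixed state -/

namespace ControlAffineSystem

variable {n m M N : ℕ} {V : Type*} (S : ControlAffineSystem n m V)

open Classical in
theorem card_removalViolates_lineInterval_zero (hN : 0 < N) (uhat : Fin m → ℝ) (x : Fin n → ℝ)
    (w : Fin (N + 1) → V) :
    (Finset.univ.filter (RemovalViolates fun k => S.lineInterval uhat 0 x (w k))).card = 0 := by
  rw [Finset.card_eq_zero, Finset.filter_eq_empty_iff]
  intro i _ hi
  exact S.not_isGreatest_lineFeasible_zero _ _ _ _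
    ((S.removalViolates_lineInterval_iff hN uhat 0 x w i).1 hi).1

/-- With a one-dimensional input all lines with a nonzero direction are the same. -/
theorem lineFeasible_nonempty_of_dim_one {uhat c c' : Fin m → ℝ} (hm : m = 1) (hc : c ≠ 0)
    {x : Fin n → ℝ} {v : Fin N → V} (h : (S.lineFeasible uhat c' x v).Nonempty) :
    (S.lineFeasible uhat c x v).Nonempty := by
  subst hm
  obtain ⟨r, hr⟩ := h
  have hc0 : c 0 ≠ 0 := fun h0 => hc (funext fun i => by rw [Subsingleton.elim i 0, h0]; rfl)
  have heq : uhat + (r * c' 0 / c 0) • c = uhat + r • c' := by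
    funext i
    rw [Subsingleton.elim i 0]
    simp only [Pi.add_apply, Pi.smul_apply, smul_eq_mul]
    field_simp
  refine ⟨r * c' 0 / c 0, ?_⟩
  simpa only [lineFeasible, Set.mem_ofPred_eq, heq] using hr

open Classical in
/-- The number of violating removals, if every removal leaves all lines feasible. -/
theorem sum_card_removalViolates_le (hN : 2 ≤ N) (hX : Convex ℝ S.stateSet)
    (hU : Convex ℝ S.inputSet) (uhat : Fin m → ℝ) (c : Fin M → Fin m → ℝ) (x : Fin n → ℝ)
    (w : Fin (N + 1) → V)
    (h : ∀ j, c j ≠ 0 → ∀ l : Fin (N + 1),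
      (S.lineFeasible uhat (c j) x fun k => w (l.succAbove k)).Nonempty) :
    ∑ j, (Finset.univ.filter
      (RemovalViolates fun k => S.lineInterval uhat (c j) x (w k))).card ≤ M := by
  refine (Finset.sum_le_card_nsmul _ _ 1 fun j _ => ?_).trans (by simp)
  by_cases hc : c j = 0
  · rw [hc, S.card_removalViolates_lineInterval_zero (by omega)]
    exact Nat.zero_le 1
  · have hconv := fun k => S.convex_lineInterval hX hU uhat (c j) x (w k)
    refine card_removalViolates_le_one hconv (iInter_nonempty_of_removals hN hconv fun l => ?_)
    rw [← S.lineFeasible_eq_iInter (by omega) uhat (c j) x fun k => w (l.succAbove k)]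
    exact h j hc l

variable [MeasurableSpace V] (P : Measure V) [IsProbabilityMeasure P]

theorem firstStageViolation_le_one (x : Fin n → ℝ) (U₀ : Set (Fin m → ℝ)) :
    S.firstStageViolation P x U₀ ≤ 1 :=
  iSup₂_le fun _ _ => prob_le_one

/-- The expected violation probability at a fixed state at which almost every sample gives a
nonempty hull. -/
theorem lintegral_firstStageViolation_hullSet_le
    (hf : Measurable fun p : (Fin n → ℝ) × V => S.f p.1 p.2)
    (hg : ∀ a b, Measurable fun p : (Fin n → ℝ) × V => S.g p.1 p.2 a b)
    (hX : IsClosed S.stateSet) (hXc : Convex ℝ S.stateSet)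
    (hU : IsCompact S.inputSet) (hUc : Convex ℝ S.inputSet) (hN : 2 ≤ N)
    (uhat : Fin m → ℝ) (c : Fin M → Fin m → ℝ) (x : Fin n → ℝ)
    (hne : ∀ᵐ v ∂(Measure.pi fun _ : Fin N => P), (S.activeLines uhat c x v).Nonempty) :
    ∫⁻ v, S.firstStageViolation P x (S.hullSet uhat c x v) ∂(Measure.pi fun _ : Fin N => P) ≤
      ENNReal.ofReal
        (∫ ν in (0 : ℝ)..1, (M : ℝ) * binomTail (ν / ((min (m + 1) M : ℕ) : ℝ)) 1 N) := by
  classical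
  have hN0 : 0 < N := by omega
  -- An active line has a nonzero direction, which excludes `M = 0` and `m = 0`.
  obtain ⟨v₀, j₀, hj₀⟩ := hne.exists
  have hM : 0 < M := j₀.pos
  have hm : m ≠ 0 := by
    rintro rfl
    exact ((S.isGreatest_lineMax_iff hX hU _ _ _ _).1 (S.mem_activeLines.1 hj₀)).1
      (Subsingleton.elim _ _)
  have hL : 0 < min (m + 1) M := by omega
  rw [integral_mul_binomTail_one M _ N hL]
  have hsum : ∫⁻ v, S.firstStageViolation P x (S.hullSet uhat c x v)
      ∂(Measure.pi fun _ : Fin N => P) ≤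
      ∑ j, ∫⁻ v, S.lineViolation P uhat (c j) x v ∂(Measure.pi fun _ : Fin N => P) := by
    rw [← lintegral_finsetSum _ fun j _ => S.measurable_lineViolation P hf hg hX hU uhat (c j) x]
    exact lintegral_mono fun v => S.firstStageViolation_hullSet_le_sum P hXc uhat c x v
  have hconv := fun (j : Fin M) (v : V) => S.convex_lineInterval hXc hUc uhat (c j) x v
  by_cases hA : M = 1 ∨ m = 1
  · refine hsum.trans ((S.sum_lintegral_lineViolation_le P hN0 hf hg hX hU uhat c x (C := M)
      ?_).trans (natCast_div_le_ofReal ?_))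
    · filter_upwards [ae_forall_removal P hne] with w hw
      refine S.sum_card_removalViolates_le hN hXc hUc uhat c x w fun j hc l => ?_
      obtain ⟨i, hi⟩ := hw l
      have hi' := (S.mem_activeLines.1 hi).nonempty
      rcases hA with hA | hA
      · have : Subsingleton (Fin M) := by rw [hA]; infer_instance
        rwa [Subsingleton.elim j i]
      · exact S.lineFeasible_nonempty_of_dim_one hA hc hi'
    · have := one_le_mul_one_sub_pow hL N
      nlinarith [(Nat.cast_nonneg M : (0 : ℝ) ≤ M)]
  push Not at hA
  by_cases hM2 : M = 2
  · subst hM2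
    have hmin : min (m + 1) 2 = 2 := by omega
    rw [hmin]
    rcases Nat.lt_or_ge N 4 with hN4 | hN4
    · obtain rfl | rfl : N = 2 ∨ N = 3 := by omega
      -- For `N = 2` the bound is `7/6`.
      · refine (lintegral_mono fun v => S.firstStageViolation_le_one P x _).trans ?_
        rw [lintegral_one, measure_univ, ENNReal.one_le_ofReal]
        norm_num
      -- For `N = 3` two lines give `8/9 ≤ 15/16`; here two disjoint pairs may use all four indices,
      -- so the count of 3 is not available.
      · refine hsum.trans ((Finset.sum_le_sum fun j _ => S.lintegral_lineViolation_three_le P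
          hf hg hX hXc hU hUc uhat (c j) x).trans ?_)
        rw [Finset.sum_const, Finset.card_univ, Fintype.card_fin, nsmul_eq_mul]
        rw [ENNReal.le_ofReal_iff_toReal_le (by finiteness) (by norm_num)]
        norm_num
    -- The count 3 is below `4 (1 - 2^(-(N+1)))`, which is at least `31/8` for `N ≥ 4`.
    · refine hsum.trans ((S.sum_lintegral_lineViolation_le P hN0 hf hg hX hU uhat c x (C := 3)
        ?_).trans (natCast_div_le_ofReal ?_))
      · filter_upwards [ae_forall_removal P hne] with w hw
        rw [Fin.sum_univ_two]
        refine card_removalViolates_add_le_three hN4 (fun k => hconv 0 (w k))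
          (fun k => hconv 1 (w k)) fun l => ?_
        rw [← S.lineFeasible_eq_iInter hN0 uhat (c 0) x fun k => w (l.succAbove k),
          ← S.lineFeasible_eq_iInter hN0 uhat (c 1) x fun k => w (l.succAbove k)]
        obtain ⟨i, hi⟩ := hw l
        have hi' := (S.mem_activeLines.1 hi).nonempty
        obtain rfl | rfl : i = 0 ∨ i = 1 := by omega
        · exact Or.inl hi'
        · exact Or.inr hi'
      · have h4 : ((1 : ℝ) - 1 / 2) ^ (N + 1) ≤ (1 - 1 / 2) ^ 5 :=
          pow_le_pow_of_le_one (by norm_num) (by norm_num) (by omega)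
        push_cast
        norm_num at h4 ⊢
        linarith
  -- Now `M ≥ 3` and `m ≥ 2`, hence `L ≥ 3` and two violating removals per line are affordable.
  · refine hsum.trans ((S.sum_lintegral_lineViolation_le P hN0 hf hg hX hU uhat c x (C := M * 2)
      ?_).trans (natCast_div_le_ofReal ?_))
    · refine Filter.Eventually.of_forall fun w => ?_
      refine (Finset.sum_le_card_nsmul _ _ 2 fun j _ =>
        card_removalViolates_le_two fun k => hconv j (w k)).trans ?_
      simp
    · push_cast
      gcongr
      exact_mod_cast two_le_mul_one_sub_pow (L := min (m + 1) M) (by omega) hN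

end ControlAffineSystem

/-! ### From a fixed state to the closed loop -/

theorem mainTheorem7 {n m K M N : ℕ} [NeZero K] {V : Type*} [MeasurableSpace V]
    (P : Measure V) [IsProbabilityMeasure P]
    (S : ControlAffineSystem n m V)
    (hf : Measurable fun p : (Fin n → ℝ) × V => S.f p.1 p.2)
    (hg : ∀ a b, Measurable fun p : (Fin n → ℝ) × V => S.g p.1 p.2 a b)
    (hX_compact : IsCompact S.stateSet) (hX_convex : Convex ℝ S.stateSet)
    (hU_compact : IsCompact S.inputSet) (hU_convex : Convex ℝ S.inputSet)
    (uhat : Fin m → ℝ) (c : Fin M → Fin m → ℝ) (I₂ : Set ℕ)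
    (ε : ℝ) (hε : ε ∈ Set.Ioo (0 : ℝ) 1)
    (hN : 2 ≤ N)
    (hadm : ∫ ν in (0 : ℝ)..1, (M : ℝ) * binomTail (ν / ((min (m + 1) M : ℕ) : ℝ)) 1 N ≤ ε)
    (x : Fin n → ℝ) (hx : x ∈ S.stateSet)
    (κ : (Fin n → ℝ) → Scenarios K V → (Fin m → ℝ))
    (hκ : Measurable fun p : (Fin n → ℝ) × Scenarios K V => κ p.1 p.2)
    (hrec : ∀ k : ℕ, ∀ᵐ ω ∂(closedLoopMeasure P K),
      ∃ u : Fin K → Fin m → ℝ, S.IsFeasibleMPC N I₂ (S.closedLoop κ x ω k) (ω k).1 u)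
    (hlaw : ∀ k : ℕ, ∀ᵐ ω ∂(closedLoopMeasure P K),
      ∃ u : Fin K → Fin m → ℝ,
        S.IsFeasibleApproxMPC N I₂ uhat c (S.closedLoop κ x ω k) (ω k).1 u ∧
        κ (S.closedLoop κ x ω k) (ω k).1 = u 0) :
    ∀ k : ℕ,
      AEMeasurable (fun ω => S.firstStageViolation P (S.closedLoop κ x ω k)
        (S.hullSet uhat c (S.closedLoop κ x ω k)
          (ControlAffineSystem.firstStageSamples N (ω k).1))) (closedLoopMeasure P K) ∧
      ∫⁻ ω, S.firstStageViolation P (S.closedLoop κ x ω k)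
        (S.hullSet uhat c (S.closedLoop κ x ω k)
          (ControlAffineSystem.firstStageSamples N (ω k).1)) ∂(closedLoopMeasure P K)
        ≤ ENNReal.ofReal ε := by
  intro k
  have hX := hX_compact.isClosed
  have hpair : Measurable fun ω : ℕ → Scenarios K V × V =>
      (S.closedLoop κ x ω k, ControlAffineSystem.firstStageSamples N (ω k).1) :=
    (S.measurable_closedLoop hf hg hκ x k).prodMk
      (ControlAffineSystem.measurable_firstStageSamples.comp (measurable_pi_apply k).fst)
  have hviol := S.measurable_firstStageViolation_hullSet (N := N) P hf hg hX hU_compact uhat c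
  refine ⟨(hviol.comp hpair).aemeasurable, ?_⟩
  have hmap := S.map_closedLoop_firstStageSamples (N := N) P hf hg hκ x k
  have hset : MeasurableSet {p : (Fin n → ℝ) × (Fin N → V) |
      (S.activeLines uhat c p.1 p.2).Nonempty} := by
    simp only [Finset.Nonempty, S.mem_activeLines, Set.ofPred_exists]
    exact MeasurableSet.iUnion fun j => S.measurableSet_isGreatest_lineMax hf hg hX hU_compact
      uhat (c j) measurable_fst measurable_snd
  -- The applied input lies in the hull, so the hull is almost surely nonempty. Under the product
  -- law this holds for almost every state and almost every independent sample.
  have hne : ∀ᵐ p ∂((closedLoopMeasure P K).map fun ω => S.closedLoop κ x ω k).prod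
      (Measure.pi fun _ : Fin N => P), (S.activeLines uhat c p.1 p.2).Nonempty := by
    rw [← hmap, ae_map_iff hpair.aemeasurable hset]
    filter_upwards [hlaw k] with ω hω
    obtain ⟨u, hu, -⟩ := hω
    exact S.activeLines_nonempty ⟨_, hu.2.1⟩
  have hprob : IsProbabilityMeasure (closedLoopMeasure P K) := by
    unfold closedLoopMeasure
    infer_instance
  have hprob' : IsProbabilityMeasure
      ((closedLoopMeasure P K).map fun ω => S.closedLoop κ x ω k) :=
    Measure.isProbabilityMeasure_map (S.measurable_closedLoop hf hg hκ x k).aemeasurable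
  rw [← lintegral_map hviol hpair, hmap, lintegral_prod _ hviol.aemeasurable]
  calc _ ≤ ∫⁻ _, ENNReal.ofReal ε ∂((closedLoopMeasure P K).map fun ω =>
        S.closedLoop κ x ω k) := by
        refine lintegral_mono_ae ((Measure.ae_ae_of_ae_prod hne).mono fun y hy => ?_)
        exact (S.lintegral_firstStageViolation_hullSet_le P hf hg hX hX_convex hU_compact
          hU_convex hN uhat c y hy).trans (ENNReal.ofReal_le_ofReal hadm)
    _ = ENNReal.ofReal ε := by simp
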